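/- Let $l,m\ge 1$ be integers and $N=m^{l+1}-1$. Let $\mathrm{MTD}_{l,m}$ be the set of probability distributions $p=(p_{i_0i_1\cdots i_l})$ on $[m]^{l+1}$ of the form $$p_{i_0 i_1\cdots i_l}=\frac1{m^l}\sum_{j=1}^{l}\lambda_j\,q_{i_{j-1},i_l},$$ where $(q_{ab})$ ranges over the real $m\times m$ matrices with nonnegative entries and row sums $1$, and $\lambda$ over the probability distributions on $[l]$. Let $V=\overline{\mathrm{MTD}}_{l,m}$ be its Zariski closure in the complex projective space $\mathbb P^N$ with homogeneous coordinates $p_{i_0\cdots i_l}$, let $L\subseteq\mathbb P^N$ be the linear span of $V$, and let $I(V), I(L)\subseteq\mathbb C[p_{i_0\cdots i_l}]$ be the homogeneous ideals of $V$ and $L$. For $0\le j\le l-1$ write $p^{(j)}_{a,r}$ for the unknown $p_{m\cdots m\,a\,m\cdots m\,r}$ with $a$ in position $j$, last letter $r$, and $m$ in all other positions; write $p_{*,r}=p_{m\cdots m\,r}$. Consider the linear forms $$p_{i_0\cdots i_l}-\sum_{j=0}^{l-1}p^{(j)}_{i_j,i_l}+(l-1)\,p_{*,i_l}\qquad(\text{at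 least two of } i_0,\dots,i_{l-1}\text{ are different from } m),$$ $$\sum_{r=1}^m p^{(j)}_{a,r}-\sum_{r=1}^m p_{*,r}\qquad(0\le j\le l-1,\ 1\le a\le m-1),$$ and the $l\times(m-1)^2$-matrix $A=(A_2\,A_3\cdots A_m)$ of linear forms, where $A_r$ is the $l\times(m-1)$-matrix with entry $p^{(j)}_{a,r}-p_{*,r}$ in row $j$ and column $a$ $(0\le j\le l-1,\ 1\le a\le m-1)$. Then: 1. $\dim L=(m-1)(lm-l+1)$, and $I(L)$ is generated by the linear forms above. 2. $I(V)$ is prime, and its image in the coordinate ring $\mathbb C[p_{i_0\cdots i_l}]/I(L)$ of $L$ is generated by the images of the $2\times2$-minors of $A$. 3. The linear forms above together with the $2\times 2$-minors of $A$ form a Gröbner basis of $I(V)$ for the degree reverse lexicographic term order in which the unknowns are ordered lexicographically by their indices, $p_{1\cdots 11}$ being the largest and $p_{m\cdots mm}$ the smallest. -/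

import Mathlib

open MvPolynomial
open scoped LinearAlgebra.Projectivization

noncomputable section

namespace MTD

/-! ### The model and its Zariski closure in complex projective space -/

/-- The states `i₀ i₁ ⋯ i_l`: words of length `l + 1` over the alphabet `[m]`, ordered
lexicographically. The letter `a ∈ {1, …, m}` is represented by `a - 1 : Fin m`, so that the first
letter is `0` and the last letter is `⊤`. -/
abbrev State (l m : ℕ) : Type := Lex (Fin (l + 1) → Fin m)

/-- The `l`-th (final) letter `i_l` of a state. -/
def State.final {l m : ℕ} (s : State l m) : Fin m := ofLex s (Fin.last l)

/-- The letter `i_j` of a state, for `0 ≤ j ≤ l - 1`. -/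
def State.letter {l m : ℕ} (s : State l m) (j : Fin l) : Fin m := ofLex s j.castSucc

/-- The map `φ_{l,m}`. The mixture weight `lam j`, `j = 0, …, l - 1`, belongs to the position `j`
of the word. -/
def phi (l m : ℕ) (q : Fin m → Fin m → ℝ) (lam : Fin l → ℝ) : State l m → ℝ :=
  fun s => 1 / (m : ℝ) ^ l * ∑ j : Fin l, lam j * q (s.letter j) s.final

/-- The model `MTD_{l,m}`: the image under `φ_{l,m}` of the product of simplices
`(Δ_{m-1})^m × Δ_{l-1}`. -/
def model (l m : ℕ) : Set (State l m → ℝ) :=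
  {p | ∃ (q : Fin m → Fin m → ℝ) (lam : Fin l → ℝ),
    (∀ a, q a ∈ stdSimplex ℝ (Fin m)) ∧ lam ∈ stdSimplex ℝ (Fin l) ∧ p = phi l m q lam}

/-- The complex projective space `ℙ^N`, with homogeneous coordinates indexed by the states
(`N + 1 = m ^ (l + 1)`). -/
abbrev PSpace (l m : ℕ) : Type := ℙ ℂ (State l m → ℂ)

/-- The model as a set of points in complex projective space. -/
def projModel (l m : ℕ) : Set (PSpace l m) :=
  {x | ∃ p ∈ model l m, ∃ h : (fun s => (p s : ℂ)) ≠ 0, x = Projectivization.mk ℂ _ h}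

/-- The homogeneous polynomials that vanish at all points of a set in projective space. (For a
homogeneous polynomial, vanishing does not depend on the chosen representative.) -/
def homogeneousVanishing {σ : Type} (S : Set (ℙ ℂ (σ → ℂ))) : Set (MvPolynomial σ ℂ) :=
  {f | (∃ n, f.IsHomogeneous n) ∧ ∀ x ∈ S, eval x.rep f = 0}

/-- The homogeneous ideal of a set in projective space. -/
def vanishingIdeal {σ : Type} (S : Set (ℙ ℂ (σ → ℂ))) : Ideal (MvPolynomial σ ℂ) :=
  Ideal.span (homogeneousVanishing S)

/-- The Zariski closure of a set in projective space. -/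
def zariskiClosure {σ : Type} (S : Set (ℙ ℂ (σ → ℂ))) : Set (ℙ ℂ (σ → ℂ)) :=
  {x | ∀ f ∈ homogeneousVanishing S, eval x.rep f = 0}

/-- The projective variety that is the Zariski closure of `MTD_{l,m}`. -/
def variety (l m : ℕ) : Set (PSpace l m) := zariskiClosure (projModel l m)

/-! ### The explicit linear forms and quadrics -/

/-- The state `m ⋯ m a m ⋯ m r` with the letter `a` in position `j ≤ l - 1` and final letter `r`. -/
def oneOff {l m : ℕ} [NeZero m] (j : Fin l) (a r : Fin m) : State l m :=
  toLex (Fin.snoc (α := fun _ => Fin m) (Function.update (fun _ : Fin l => (⊤ : Fin m)) j a) r)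

/-- The state `m ⋯ m r`. -/
def allTop {l m : ℕ} [NeZero m] (r : Fin m) : State l m :=
  toLex (Fin.snoc (α := fun _ => Fin m) (fun _ : Fin l => (⊤ : Fin m)) r)

/-- The letter `k + 1 ∈ {1, …, m - 1}`, that is, any letter but the last one. -/
def lowLetter {m : ℕ} (k : Fin (m - 1)) : Fin m := ⟨k, by omega⟩

/-- The letter `k + 2 ∈ {2, …, m}`, that is, any letter but the first one. -/
def highLetter {m : ℕ} (k : Fin (m - 1)) : Fin m := ⟨k + 1, by omega⟩

/-- `p_{i₀ ⋯ i_l} - ∑_j p_{m ⋯ m i_j m ⋯ m i_l} + (l - 1) p_{m ⋯ m i_l}`. -/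
def linearForm₁ {l m : ℕ} [NeZero m] (s : State l m) : MvPolynomial (State l m) ℂ :=
  X s - ∑ j : Fin l, X (oneOff j (s.letter j) s.final) + C ((l : ℂ) - 1) * X (allTop s.final)

/-- `∑_r p_{m ⋯ m a m ⋯ m r} - ∑_r p_{m ⋯ m r}`, with the letter `a` in position `j`. -/
def linearForm₂ {l m : ℕ} [NeZero m] (j : Fin l) (a : Fin m) : MvPolynomial (State l m) ℂ :=
  ∑ r : Fin m, X (oneOff j a r) - ∑ r : Fin m, X (allTop r)

/-- The explicit linear forms: the first kind for the states with at least two of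
`i₀, …, i_{l-1}` different from `m`, the second kind for `0 ≤ j ≤ l - 1` and
`1 ≤ i_j ≤ m - 1`. -/
def linearForms (l m : ℕ) [NeZero m] : Set (MvPolynomial (State l m) ℂ) :=
  {f | ∃ s : State l m, (∃ j k : Fin l, j ≠ k ∧ s.letter j ≠ ⊤ ∧ s.letter k ≠ ⊤) ∧
      f = linearForm₁ s} ∪
  {f | ∃ (j : Fin l) (a : Fin (m - 1)), f = linearForm₂ j (lowLetter a)}

/-- The `l × (m - 1)²`-matrix `A = (A₂ A₃ ⋯ A_m)`. Its columns are indexed by pairs `(r, a)`, the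
first component being the number of the block and the second one the column inside the block; the
entry in row `j` and column `(r, a)` is `p_{m ⋯ m a m ⋯ m r} - p_{m ⋯ m r}`, with `a` in
position `j`, `2 ≤ r ≤ m` and `1 ≤ a ≤ m - 1`. -/
def matrixA (l m : ℕ) [NeZero m] :
    Matrix (Fin l) (Fin (m - 1) × Fin (m - 1)) (MvPolynomial (State l m) ℂ) :=
  Matrix.of fun j c => X (oneOff j (lowLetter c.2) (highLetter c.1)) - X (allTop (highLetter c.1))

/-- The `2 × 2`-minors of `A`, with rows `j < k` and columns `c < d` (from left to right). -/
def minors (l m : ℕ) [NeZero m] : Set (MvPolynomial (State l m) ℂ) :=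
  {f | ∃ (j k : Fin l) (c d : Fin (m - 1) × Fin (m - 1)), j < k ∧ toLex c < toLex d ∧
    f = ((matrixA l m).submatrix ![j, k] ![c, d]).det}

/-! ### The (degree) reverse lexicographic term order and Gröbner bases -/

section RevLex

variable {σ : Type}

/-- Exponent vectors with the degree reverse lexicographic order. -/
def DegRevLex (σ : Type) : Type := σ →₀ ℕ

instance : AddCommMonoid (DegRevLex σ) := inferInstanceAs (AddCommMonoid (σ →₀ ℕ))

/-- First compare the degrees, then the exponents of the last variable, where a smaller exponent
makes a larger monomial, then those of the last but one variable, and so on. -/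
def DegRevLex.key (a : DegRevLex σ) : Lex (ℕ × Colex (σ → ℕᵒᵈ)) :=
  toLex (Finsupp.degree (show σ →₀ ℕ from a),
    toColex fun i => OrderDual.toDual ((show σ →₀ ℕ from a) i))

theorem DegRevLex.key_injective : Function.Injective (DegRevLex.key (σ := σ)) := by
  intro a b h
  have h2 := congrArg (fun z => (ofLex z).2) h
  refine Finsupp.ext fun i => ?_
  exact congrFun h2 i

variable [LinearOrder σ] [Finite σ]

instance : LinearOrder (DegRevLex σ) := LinearOrder.lift' DegRevLex.key DegRevLex.key_injective

theorem DegRevLex.lt_iff (a b : σ →₀ ℕ) :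
    @LT.lt (DegRevLex σ) _ a b ↔ a.degree < b.degree ∨
      a.degree = b.degree ∧ ∃ i, (∀ j, i < j → a j = b j) ∧ b i < a i := by
  change DegRevLex.key a < DegRevLex.key b ↔ _
  unfold DegRevLex.key
  rw [Prod.Lex.toLex_lt_toLex]
  rfl

theorem DegRevLex.add_lt_add (a b c : DegRevLex σ) (h : a < b) : a + c < b + c := by
  replace h := (DegRevLex.lt_iff a b).1 h
  refine (DegRevLex.lt_iff _ _).2 ?_
  change Finsupp.degree ((show σ →₀ ℕ from a) + (show σ →₀ ℕ from c)) <
      Finsupp.degree ((show σ →₀ ℕ from b) + (show σ →₀ ℕ from c)) ∨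
    Finsupp.degree ((show σ →₀ ℕ from a) + (show σ →₀ ℕ from c)) =
      Finsupp.degree ((show σ →₀ ℕ from b) + (show σ →₀ ℕ from c)) ∧ _
  rw [map_add, map_add]
  rcases h with h | ⟨h, i, hi, hlt⟩
  · exact Or.inl (Nat.add_lt_add_right h _)
  · refine Or.inr ⟨congrArg (· + _) h, i, fun j hj => ?_, ?_⟩
    · exact congrArg (· + (show σ →₀ ℕ from c) j) (hi j hj)
    · exact Nat.add_lt_add_right hlt ((show σ →₀ ℕ from c) i)

instance : IsOrderedAddMonoid (DegRevLex σ) where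
  add_le_add_left a b h c := by
    rcases h.lt_or_eq with h | h
    · exact (DegRevLex.add_lt_add a b c h).le
    · rw [h]

theorem DegRevLex.monotone (a b : σ →₀ ℕ) (h : a ≤ b) : @LE.le (DegRevLex σ) _ a b := by
  rcases eq_or_ne a b with rfl | hne
  · exact @le_refl (DegRevLex σ) _ a
  · refine @le_of_lt (DegRevLex σ) _ a b ((DegRevLex.lt_iff a b).2 (Or.inl ?_))
    have hd : a.degree + (b - a).degree = b.degree := by
      rw [← map_add, add_tsub_cancel_of_le h]
    have hp : (b - a).degree ≠ 0 := by
      rw [Ne, Finsupp.degree_eq_zero_iff, tsub_eq_zero_iff_le]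
      exact fun h' => hne (le_antisymm h h')
    omega

instance : WellFoundedLT (DegRevLex σ) :=
  have : WellQuasiOrderedLE (DegRevLex σ) :=
    Monotone.wellQuasiOrderedLE_of_wellQuasiOrderedLE_of_surjective (α := σ →₀ ℕ) (f := fun a : σ →₀ ℕ => (a : DegRevLex σ))
      (fun a b h => DegRevLex.monotone a b h) (fun a => ⟨a, rfl⟩)
  inferInstance

variable (σ) in
/-- The (degree) reverse lexicographic term order in the variables `X i`, `i : σ`, where `X i` is
larger than `X j` if `i < j`. -/
def degRevLex : MonomialOrder σ where
  syn := DegRevLex σ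
  toSyn := { toEquiv := Equiv.refl _, map_add' := fun _ _ => rfl }
  toSyn_monotone := fun a b h => DegRevLex.monotone a b h

theorem degRevLex_lt_iff (a b : σ →₀ ℕ) :
    (degRevLex σ).toSyn a < (degRevLex σ).toSyn b ↔ a.degree < b.degree ∨
      a.degree = b.degree ∧ ∃ i, (∀ j, i < j → a j = b j) ∧ b i < a i :=
  DegRevLex.lt_iff a b

end RevLex

/-- `G` is a Gröbner basis of the ideal `I` with respect to the term order `ord`. -/
def IsGroebnerBasis {σ : Type} (ord : MonomialOrder σ) (G : Set (MvPolynomial σ ℂ))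
    (I : Ideal (MvPolynomial σ ℂ)) : Prop :=
  G.Finite ∧ G ⊆ I ∧
    Ideal.span (ord.leadingTerm '' G) = Ideal.span (ord.leadingTerm '' (I : Set (MvPolynomial σ ℂ)))

end MTD

end

noncomputable section

set_option linter.unusedSectionVars false

namespace MTD

/-! ### Letters of states -/

section States

variable {l m : ℕ}

/-! Let `u` be the last row of `q` and let `y` be the matrix of differences of the rows of `q` with
that row, both scaled by `1 / m ^ l`. As the weights sum to one, a point of the model has
coordinates `u_r + ∑_j λ_j y_{i_j, r}`, where `r = i_l` and `y` has vanishing row sums and last row.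
So `y` is given by its entries indexed by `Col m`, and `rowExt` restores the others. Replacing the
products `λ_j y_c` by independent values `d_{j,c}` gives the linear map `point`, whose image is the
cone over the linear span. The matrix `A` reads off `d`, and the variety is cut out by `d` having
rank at most one.

The constraints on the model cost nothing. After rescaling, a full-dimensional box of real
parameters lands on the cone over the model (`exists_mem_model_smul_eq_point`), so a homogeneous
polynomial vanishes on the model exactly when the substitution `param` kills it. The ideal of the
variety is therefore the kernel of a homomorphism into a polynomial ring, hence prime.

For the Gröbner basis, call a monomial standard if no leading monomial of the proposed basis divides
it. It involves only the unknowns at `allTop r` and `entryState j c`, whose images have leading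
monomials `u_r` and `λ_j y_c`. The leading exponent of its image thus records the exponents at
`allTop r` and the row and column sums of the matrix of the other exponents. The leading monomials
of the minors force the support of that matrix to be a chain, and such a matrix is determined by its
marginals (`eq_of_chain_of_marginals`). Distinct standard monomials have images with distinct
leading monomials, so no nonzero combination of them lies in the kernel. Division with remainder
then yields generation and the Gröbner property together (`groebner_ker_param`). -/

theorem State.ext_letter {s t : State l m} (h : ∀ j, s.letter j = t.letter j)
    (hf : s.final = t.final) : s = t := by
  apply ofLex.injective
  funext i
  induction i using Fin.lastCases with
  | last => exact hf
  | cast j => exact h j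

theorem State.lt_of_letter {s t : State l m} (j : Fin l)
    (h : ∀ k < j, s.letter k = t.letter k) (hj : s.letter j < t.letter j) : s < t := by
  refine ⟨j.castSucc, fun i hi => ?_, hj⟩
  induction i using Fin.lastCases with
  | last => exact absurd hi (by simp [Fin.lt_def])
  | cast k => exact h k (by simpa using hi)

theorem State.lt_of_final {s t : State l m}
    (h : ∀ k, s.letter k = t.letter k) (hf : s.final < t.final) : s < t := by
  refine ⟨Fin.last l, fun i hi => ?_, hf⟩
  induction i using Fin.lastCases with
  | last => exact absurd hi (lt_irrefl _)
  | cast k => exact h k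

theorem State.lt_of_letter_le {s t : State l m}
    (h : ∀ k, s.letter k ≤ t.letter k) (hf : s.final = t.final) (hne : s ≠ t) : s < t := by
  have hle : ofLex s ≤ ofLex t := by
    intro i
    induction i using Fin.lastCases with
    | last => exact hf.le
    | cast j => exact h j
  exact Pi.toLex_strictMono (lt_of_le_of_ne hle fun h => hne (ofLex.injective h))

variable [NeZero m]

@[simp] theorem final_allTop (r : Fin m) : (allTop r : State l m).final = r := by
  simp [State.final, allTop]

@[simp] theorem letter_allTop (r : Fin m) (j : Fin l) :
    (allTop r : State l m).letter j = ⊤ := by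
  simp [State.letter, allTop]

@[simp] theorem final_oneOff (j : Fin l) (a r : Fin m) : (oneOff j a r).final = r :=
  Fin.snoc_last (α := fun _ => Fin m) _ _

theorem letter_oneOff (j k : Fin l) (a r : Fin m) :
    (oneOff j a r).letter k = if k = j then a else ⊤ := by
  simp [State.letter, oneOff, Function.update_apply]

@[simp] theorem letter_oneOff_self (j : Fin l) (a r : Fin m) :
    (oneOff j a r).letter j = a := by
  simp [letter_oneOff]

theorem oneOff_top (j : Fin l) (r : Fin m) : oneOff j ⊤ r = allTop r :=
  State.ext_letter (fun k => by simp [letter_oneOff]) (by simp)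

/-- A state in which at most one of the letters `i₀, …, i_{l-1}` is different from `m`. -/
theorem exists_eq_oneOff (hl : 0 < l) {s : State l m}
    (h : ¬∃ j k : Fin l, j ≠ k ∧ s.letter j ≠ ⊤ ∧ s.letter k ≠ ⊤) :
    ∃ j, s = oneOff j (s.letter j) s.final := by
  have key : ∃ j, ∀ k, k ≠ j → s.letter k = ⊤ := by
    by_cases h' : ∃ j, s.letter j ≠ ⊤
    · obtain ⟨j, hj⟩ := h'
      refine ⟨j, fun k hk => ?_⟩
      by_contra hk'
      exact h ⟨j, k, hk.symm, hj, hk'⟩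
    · push Not at h'
      exact ⟨⟨0, hl⟩, fun k _ => h' k⟩
  obtain ⟨j, hj⟩ := key
  refine ⟨j, State.ext_letter (fun k => ?_) (by simp)⟩
  rw [letter_oneOff]
  split_ifs with hk
  · rw [hk]
  · exact hj k hk

theorem val_top : ((⊤ : Fin m) : ℕ) = m - 1 := by
  obtain ⟨n, rfl⟩ := Nat.exists_eq_succ_of_ne_zero (NeZero.ne m)
  rfl

theorem lowLetter_ne_top (a : Fin (m - 1)) : lowLetter a ≠ (⊤ : Fin m) := by
  intro h
  have h2 := congrArg Fin.val h
  rw [val_top] at h2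
  exact absurd h2 (by simp [lowLetter]; omega)

theorem highLetter_ne_zero (a : Fin (m - 1)) : highLetter a ≠ (0 : Fin m) := by
  intro h
  have h2 := congrArg Fin.val h
  simp [highLetter] at h2

theorem eq_top_or_lowLetter (a : Fin m) : a = ⊤ ∨ ∃ k, a = lowLetter k := by
  by_cases h : (a : ℕ) < m - 1
  · exact Or.inr ⟨⟨a, h⟩, rfl⟩
  · left
    apply Fin.ext
    rw [val_top]
    omega

theorem eq_zero_or_highLetter (r : Fin m) : r = 0 ∨ ∃ k, r = highLetter k := by
  by_cases h : (r : ℕ) = 0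
  · exact Or.inl (Fin.ext (by simpa using h))
  · refine Or.inr ⟨⟨r - 1, by omega⟩, Fin.ext ?_⟩
    simp [highLetter]
    omega

theorem sum_eq_zero_add_highLetter {M : Type*} [AddCommMonoid M] (f : Fin m → M) :
    ∑ r, f r = f 0 + ∑ k : Fin (m - 1), f (highLetter k) := by
  obtain ⟨n, rfl⟩ := Nat.exists_eq_succ_of_ne_zero (NeZero.ne m)
  rw [Fin.sum_univ_succ]
  rfl

end States

/-! ### Completing a matrix to one with vanishing row sums -/

/-- The columns `(r, a)` of the matrix `A`. -/
abbrev Col (m : ℕ) : Type := Fin (m - 1) × Fin (m - 1)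

section RowExt

variable {m : ℕ} [NeZero m] {R S : Type*} [CommRing R] [CommRing S]

/-- The `m × m`-matrix with vanishing row sums and vanishing last row whose entries in row
`lowLetter a` and column `highLetter r` are `d (r, a)`. -/
def rowExt (d : Col m → R) (a r : Fin m) : R :=
  if ha : (a : ℕ) < m - 1 then
    if (r : ℕ) = 0 then -∑ k, d (k, ⟨a, ha⟩) else d (⟨r - 1, by omega⟩, ⟨a, ha⟩)
  else 0

@[simp] theorem rowExt_top (d : Col m → R) (r : Fin m) : rowExt d ⊤ r = 0 := by
  simp [rowExt]

@[simp] theorem rowExt_lowLetter_zero (d : Col m → R) (a : Fin (m - 1)) :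
    rowExt d (lowLetter a) 0 = -∑ k, d (k, a) := by
  simp [rowExt, lowLetter]

@[simp] theorem rowExt_lowLetter_highLetter (d : Col m → R) (a r : Fin (m - 1)) :
    rowExt d (lowLetter a) (highLetter r) = d (r, a) := by
  simp [rowExt, lowLetter, highLetter]

theorem sum_rowExt (d : Col m → R) (a : Fin m) : ∑ r, rowExt d a r = 0 := by
  rcases eq_top_or_lowLetter a with rfl | ⟨a, rfl⟩
  · simp
  · simp [sum_eq_zero_add_highLetter]

/-- A matrix with vanishing row sums and vanishing last row is recovered from its entries. -/
theorem rowExt_restrict (w : Fin m → Fin m → R) (h : ∀ r, w ⊤ r = 0) (hs : ∀ a, ∑ r, w a r = 0)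
    (a r : Fin m) : rowExt (fun c : Col m => w (lowLetter c.2) (highLetter c.1)) a r = w a r := by
  rcases eq_top_or_lowLetter a with rfl | ⟨a, rfl⟩
  · simp [h]
  · rcases eq_zero_or_highLetter r with rfl | ⟨r, rfl⟩
    · have := hs (lowLetter a)
      rw [sum_eq_zero_add_highLetter] at this
      rw [rowExt_lowLetter_zero, eq_neg_of_add_eq_zero_left this]
    · simp

theorem map_rowExt (φ : R →+* S) (d : Col m → R) (a r : Fin m) :
    φ (rowExt d a r) = rowExt (fun c => φ (d c)) a r := by
  unfold rowExt
  split_ifs <;> simp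

theorem rowExt_zero (a r : Fin m) : rowExt (fun _ => (0 : R)) a r = 0 := by
  simp [rowExt]

theorem rowExt_add (d e : Col m → R) (a r : Fin m) :
    rowExt (d + e) a r = rowExt d a r + rowExt e a r := by
  unfold rowExt
  split_ifs <;> simp [Finset.sum_add_distrib, add_comm]

theorem rowExt_smul (x : R) (d : Col m → R) (a r : Fin m) :
    rowExt (fun c => x * d c) a r = x * rowExt d a r := by
  unfold rowExt
  split_ifs <;> simp [Finset.mul_sum]

end RowExt

/-! ### The points of the linear span -/

section Point

variable {l m : ℕ} [NeZero m] {R S : Type*} [CommRing R] [CommRing S]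

/-- The point with coordinates `u r` at the states `m ⋯ m r` and `A`-matrix `d`. -/
def point (u : Fin m → R) (d : Fin l → Col m → R) : State l m → R :=
  fun s => u s.final + ∑ j, rowExt (d j) (s.letter j) s.final

@[simp] theorem point_allTop (u : Fin m → R) (d : Fin l → Col m → R) (r : Fin m) :
    point u d (allTop r) = u r := by
  simp [point]

theorem point_oneOff (u : Fin m → R) (d : Fin l → Col m → R) (j : Fin l) (a r : Fin m) :
    point u d (oneOff j a r) = u r + rowExt (d j) a r := by
  rw [point, Finset.sum_eq_single j]
  · simp
  · intro k _ hk
    simp [letter_oneOff, hk]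
  · simp

theorem map_point (φ : R →+* S) (u : Fin m → R) (d : Fin l → Col m → R) (s : State l m) :
    φ (point u d s) = point (fun r => φ (u r)) (fun j c => φ (d j c)) s := by
  simp [point, map_rowExt]

theorem point_add (u u' : Fin m → R) (d d' : Fin l → Col m → R) :
    point (u + u') (d + d') = point u d + point u' d' := by
  funext s
  simp only [point, Pi.add_apply, rowExt_add, Finset.sum_add_distrib]
  ring

theorem point_smul (x : R) (u : Fin m → R) (d : Fin l → Col m → R) :
    point (x • u) (x • d) = x • point u d := by
  funext s
  simp only [point, Pi.smul_apply, smul_eq_mul, mul_add, Finset.mul_sum]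
  congr 1
  exact Finset.sum_congr rfl fun j _ => rowExt_smul x (d j) _ _

variable [Algebra ℂ R]

/-- The sum over `j` produces `u` at the final letter `l` times; one copy cancels against `X s` and
the correction term `(l - 1)` restores the rest. -/
theorem aeval_linearForm₁_point (u : Fin m → R) (d : Fin l → Col m → R) (s : State l m) :
    aeval (point u d) (linearForm₁ s) = 0 := by
  simp only [linearForm₁, map_add, map_sub, map_sum, map_mul, aeval_X, point_oneOff, point_allTop,
    Finset.sum_add_distrib, aeval_C]
  simp [point]
  ring

theorem aeval_linearForm₂_point (u : Fin m → R) (d : Fin l → Col m → R) (j : Fin l) (a : Fin m) :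
    aeval (point u d) (linearForm₂ j a) = 0 := by
  simp [linearForm₂, point_oneOff, Finset.sum_add_distrib, sum_rowExt]

theorem aeval_point_of_mem_linearForms (u : Fin m → R) (d : Fin l → Col m → R)
    {f : MvPolynomial (State l m) ℂ} (hf : f ∈ linearForms l m) : aeval (point u d) f = 0 := by
  rcases hf with ⟨s, -, rfl⟩ | ⟨j, a, rfl⟩
  · exact aeval_linearForm₁_point u d s
  · exact aeval_linearForm₂_point u d j _

/-- The parameter `d` is recovered linearly from the point, so conditions on `A` are conditions on
`d`. -/
theorem aeval_point_matrixA (u : Fin m → R) (d : Fin l → Col m → R) (j : Fin l) (c : Col m) :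
    aeval (point u d) (matrixA l m j c) = d j c := by
  simp [matrixA, point_oneOff]

theorem aeval_point_of_mem_minors (u : Fin m → R) (x : Fin l → R) (y : Col m → R)
    {f : MvPolynomial (State l m) ℂ} (hf : f ∈ minors l m) :
    aeval (point u fun j c => x j * y c) f = 0 := by
  obtain ⟨j, k, c, d, -, -, rfl⟩ := hf
  rw [Matrix.det_fin_two]
  simp only [map_sub, map_mul, Matrix.submatrix_apply, aeval_point_matrixA, Matrix.cons_val_zero,
    Matrix.cons_val_one]
  ring

end Point

/-! ### Reduction modulo the linear forms -/

section Reduction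

variable {l m : ℕ} [NeZero m]

/-- The reduction modulo the linear forms. -/
def reduction (l m : ℕ) [NeZero m] :
    MvPolynomial (State l m) ℂ →ₐ[ℂ] MvPolynomial (State l m) ℂ :=
  aeval (point (fun r => X (allTop r)) fun j c => matrixA l m j c)

theorem X_oneOff_sub_mem (j : Fin l) (a r : Fin m) :
    (X (oneOff j a r) - (X (allTop r) + rowExt (matrixA l m j) a r) :
      MvPolynomial (State l m) ℂ) ∈ Ideal.span (linearForms l m) := by
  rcases eq_top_or_lowLetter a with rfl | ⟨a, rfl⟩
  · simp [oneOff_top]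
  · rcases eq_zero_or_highLetter r with rfl | ⟨r, rfl⟩
    · have h : (X (oneOff j (lowLetter a) 0) - (X (allTop 0) +
          rowExt (matrixA l m j) (lowLetter a) 0) : MvPolynomial (State l m) ℂ) =
          linearForm₂ j (lowLetter a) := by
        simp only [rowExt_lowLetter_zero, matrixA, Matrix.of_apply, linearForm₂,
          sum_eq_zero_add_highLetter, Finset.sum_sub_distrib]
        ring
      rw [h]
      exact Ideal.subset_span (Or.inr ⟨j, a, rfl⟩)
    · simp [matrixA]

/-- For the states excluded from the list the form is identically zero: one summand is `X s` itself
and the other `l - 1` are all `X (allTop s.final)`. -/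
theorem linearForm₁_mem (hl : 0 < l) (s : State l m) :
    linearForm₁ s ∈ Ideal.span (linearForms l m) := by
  by_cases h : ∃ j k : Fin l, j ≠ k ∧ s.letter j ≠ ⊤ ∧ s.letter k ≠ ⊤
  · exact Ideal.subset_span (Or.inl ⟨s, h, rfl⟩)
  · obtain ⟨j, hs⟩ := exists_eq_oneOff hl h
    have hj : ∀ k, k ≠ j → s.letter k = ⊤ := fun k hk => by
      rw [hs, letter_oneOff, if_neg hk]
    have h0 : linearForm₁ s = 0 := by
      have : ∑ k : Fin l, (X (oneOff k (s.letter k) s.final) : MvPolynomial (State l m) ℂ) =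
          X s + C ((l : ℂ) - 1) * X (allTop s.final) := by
        rw [← Finset.add_sum_erase _ _ (Finset.mem_univ j), ← hs]
        congr 1
        rw [Finset.sum_congr rfl (g := fun _ => X (allTop s.final))]
        · rw [Finset.sum_const, Finset.card_erase_of_mem (Finset.mem_univ j), Finset.card_univ,
            Fintype.card_fin, nsmul_eq_mul, Nat.cast_sub hl]
          simp
        · intro k hk
          rw [hj k (Finset.ne_of_mem_erase hk), oneOff_top]
      rw [linearForm₁, this]
      ring
    rw [h0]
    exact Submodule.zero_mem _

theorem X_sub_reduction_mem (hl : 0 < l) (s : State l m) :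
    X s - reduction l m (X s) ∈ Ideal.span (linearForms l m) := by
  have h : X s - reduction l m (X s) = linearForm₁ s +
      ∑ j, (X (oneOff j (s.letter j) s.final) -
        (X (allTop s.final) + rowExt (matrixA l m j) (s.letter j) s.final)) := by
    simp only [reduction, aeval_X, point, linearForm₁, Finset.sum_sub_distrib,
      Finset.sum_add_distrib]
    simp
    ring
  rw [h]
  exact Ideal.add_mem _ (linearForm₁_mem hl s) (Ideal.sum_mem _ fun j _ => X_oneOff_sub_mem j _ _)

/-- The quotient map and its composite with `reduction` are algebra homomorphisms that agree on the
unknowns. -/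
theorem sub_reduction_mem (hl : 0 < l) (f : MvPolynomial (State l m) ℂ) :
    f - reduction l m f ∈ Ideal.span (linearForms l m) := by
  rw [← Ideal.Quotient.eq]
  have : (Ideal.Quotient.mkₐ ℂ (Ideal.span (linearForms l m))) =
      (Ideal.Quotient.mkₐ ℂ (Ideal.span (linearForms l m))).comp (reduction l m) := by
    refine MvPolynomial.algHom_ext fun s => ?_
    exact Ideal.Quotient.eq.2 (X_sub_reduction_mem hl s)
  exact DFunLike.congr_fun this f

/-- The coordinates of a common zero of the linear forms are determined by those at the states
`m ⋯ m r` and `m ⋯ m a m ⋯ m r`. -/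
theorem eq_point_of_eval_linearForms (hl : 0 < l) {x : State l m → ℂ}
    (hx : ∀ f ∈ linearForms l m, eval x f = 0) :
    x = point (fun r => x (allTop r)) (fun j c => eval x (matrixA l m j c)) := by
  funext s
  have h : Ideal.span (linearForms l m) ≤ RingHom.ker (eval x) := Ideal.span_le.2 hx
  have h2 := h (X_sub_reduction_mem hl s)
  rw [RingHom.mem_ker, map_sub, sub_eq_zero, eval_X, reduction, aeval_X, map_point] at h2
  simpa using h2

/-- A polynomial that vanishes at all points of the linear span is in the ideal generated by the
linear forms. -/
theorem mem_span_linearForms_of_eval_point (hl : 0 < l) {f : MvPolynomial (State l m) ℂ}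
    (hf : ∀ (u : Fin m → ℂ) (d : Fin l → Col m → ℂ), eval (point u d) f = 0) :
    f ∈ Ideal.span (linearForms l m) := by
  -- Evaluating the reduction of `f` anywhere amounts to evaluating `f` at a point of the linear
  -- span, so the reduction is zero as a function, hence as a polynomial.
  have h0 : reduction l m f = 0 := by
    apply MvPolynomial.funext
    intro x
    have h : (eval x).comp (reduction l m : _ →+* _) =
        eval (point (fun r => x (allTop r)) (fun j c => eval x (matrixA l m j c))) := by
      refine MvPolynomial.ringHom_ext (fun c => ?_) (fun s => ?_)
      · simp [reduction]
      · simp [reduction, map_point]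
    rw [map_zero, ← hf, ← h]
    rfl
  simpa [h0] using sub_reduction_mem hl f

end Reduction

/-! ### A criterion for Gröbner bases -/

section Groebner

variable {σ τ : Type}

/-- If `0` is the only element of an ideal `I` no monomial of which is divisible by the leading
monomial of a nonzero element of `G ⊆ I`, then `G` generates `I`, and the leading terms of `G`
generate the initial ideal. -/
theorem span_eq_and_span_leadingTerm_eq (ord : MonomialOrder σ) {G : Set (MvPolynomial σ ℂ)}
    {I : Ideal (MvPolynomial σ ℂ)} (hG : G ⊆ I)
    (h : ∀ r ∈ I, (∀ c ∈ r.support, ∀ b ∈ G, b ≠ 0 → ¬ ord.degree b ≤ c) → r = 0) :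
    Ideal.span G = I ∧
      Ideal.span (ord.leadingTerm '' G) =
        Ideal.span (ord.leadingTerm '' (I : Set (MvPolynomial σ ℂ))) := by
  have key : ∀ f ∈ I, ∃ g : {b | b ∈ G ∧ b ≠ 0} →₀ MvPolynomial σ ℂ,
      f = Finsupp.linearCombination _
        (fun b : {b | b ∈ G ∧ b ≠ 0} => (b : MvPolynomial σ ℂ)) g ∧
      ∀ b : {b | b ∈ G ∧ b ≠ 0},
        ord.toSyn (ord.degree ((b : MvPolynomial σ ℂ) * g b)) ≤ ord.toSyn (ord.degree f) := by
    intro f hf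
    -- Zero is removed from `G` because division needs invertible leading coefficients.
    obtain ⟨g, r, hfr, hdeg, hr⟩ := ord.div_set (B := {b | b ∈ G ∧ b ≠ 0})
      (fun b hb => isUnit_iff_ne_zero.2 (ord.leadingCoeff_ne_zero_iff.2 hb.2)) f
    have hmem : Finsupp.linearCombination _ (fun b : {b | b ∈ G ∧ b ≠ 0} =>
        (b : MvPolynomial σ ℂ)) g ∈ I := by
      rw [Finsupp.linearCombination_apply]
      exact Submodule.sum_mem _ fun b _ => I.smul_mem _ (hG b.2.1)
    have hrI : r ∈ I := by
      have : r = f - Finsupp.linearCombination _ (fun b : {b | b ∈ G ∧ b ≠ 0} =>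
        (b : MvPolynomial σ ℂ)) g := by rw [hfr]; ring
      rw [this]
      exact I.sub_mem hf hmem
    have hr0 : r = 0 := h r hrI fun c hc b hb hb0 => hr c hc b ⟨hb, hb0⟩
    exact ⟨g, by rw [hfr, hr0, add_zero], hdeg⟩
  refine ⟨le_antisymm (Ideal.span_le.2 hG) fun f hf => ?_,
    le_antisymm (Ideal.span_mono (Set.image_mono hG)) (Ideal.span_le.2 ?_)⟩
  · obtain ⟨g, hg, -⟩ := key f hf
    rw [hg, Finsupp.linearCombination_apply]
    exact Submodule.sum_mem _ fun b _ => Ideal.mul_mem_left _ _ (Ideal.subset_span b.2.1)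
  · rintro _ ⟨f, hf, rfl⟩
    by_cases hf0 : f = 0
    · simp [hf0]
    obtain ⟨g, hg, hdeg⟩ := key f hf
    have hc : f.coeff (ord.degree f) ≠ 0 := ord.coeff_degree_ne_zero_iff.2 hf0
    -- The leading monomial of `f` occurs in some summand. No summand has a larger leading monomial,
    -- so it is the leading monomial of that summand and is divisible by that of `b`.
    obtain ⟨b, hb⟩ : ∃ b : {b | b ∈ G ∧ b ≠ 0},
        ((b : MvPolynomial σ ℂ) * g b).coeff (ord.degree f) ≠ 0 := by
      by_contra! hall
      apply hc
      refine (congrArg (coeff (ord.degree f)) hg).trans ?_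
      rw [Finsupp.linearCombination_apply, Finsupp.sum, coeff_sum]
      refine Finset.sum_eq_zero fun b _ => ?_
      rw [smul_eq_mul, mul_comm]
      exact hall b
    have hdeg' : ord.degree ((b : MvPolynomial σ ℂ) * g b) = ord.degree f :=
      ord.toSyn.injective (le_antisymm (hdeg b) (ord.le_degree (mem_support_iff.2 hb)))
    have hg0 : g b ≠ 0 := by
      rintro h0
      simp [h0] at hb
    rw [ord.degree_mul b.2.2 hg0] at hdeg'
    have : ord.leadingTerm f =
        monomial (ord.degree (g b)) (ord.leadingCoeff f / ord.leadingCoeff (b : MvPolynomial σ ℂ)) *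
          ord.leadingTerm (b : MvPolynomial σ ℂ) := by
      rw [MonomialOrder.leadingTerm, MonomialOrder.leadingTerm, monomial_mul,
        div_mul_cancel₀ _ (ord.leadingCoeff_ne_zero_iff.2 b.2.2), add_comm, hdeg']
    rw [this]
    exact Ideal.mul_mem_left _ _ (Ideal.subset_span ⟨b, b.2.1, rfl⟩)

/-- If the leading exponents of the images of the monomials of `r` under a substitution are
distinct, then the substitution does not annihilate `r`. -/
theorem eq_zero_of_aeval_eq_zero (ord : MonomialOrder τ) {g : σ → MvPolynomial τ ℂ}
    (hg : ∀ s, g s ≠ 0) {r : MvPolynomial σ ℂ}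
    (hinj : Set.InjOn (fun α : σ →₀ ℕ => α.sum fun s n => n • ord.degree (g s)) r.support)
    (hr : aeval g r = 0) : r = 0 := by
  by_contra hr0
  set E : (σ →₀ ℕ) → (τ →₀ ℕ) := fun α => α.sum fun s n => n • ord.degree (g s) with hE
  have hdeg : ∀ α : σ →₀ ℕ, ord.degree (α.prod fun s n => g s ^ n) = E α := by
    intro α
    rw [Finsupp.prod, ord.degree_prod fun s _ => pow_ne_zero _ (hg s)]
    simp [hE, Finsupp.sum, ord.degree_pow]
  have hne : ∀ α : σ →₀ ℕ, (α.prod fun s n => g s ^ n) ≠ 0 := fun α =>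
    Finset.prod_ne_zero_iff.2 fun s _ => pow_ne_zero _ (hg s)
  -- At the largest leading exponent, only the image of this one monomial contributes, by
  -- injectivity; nothing can cancel it.
  obtain ⟨α, hα, hmax⟩ := Finset.exists_max_image r.support (fun α => ord.toSyn (E α))
    (Finset.nonempty_iff_ne_empty.2 fun h => hr0 (support_eq_empty.1 h))
  have hcoeff : (aeval g r).coeff (E α) =
      r.coeff α * (α.prod fun s n => g s ^ n).coeff (E α) := by
    rw [aeval_def, eval₂_eq, coeff_sum, Finset.sum_eq_single α]
    · rw [algebraMap_eq, coeff_C_mul]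
      rfl
    · intro β hβ hne'
      rw [algebraMap_eq, coeff_C_mul]
      refine mul_eq_zero_of_right _ (ord.coeff_eq_zero_of_lt (f := β.prod fun s n => g s ^ n) ?_)
      rw [hdeg]
      exact lt_of_le_of_ne (hmax β hβ) fun h => hne' (hinj hβ hα (ord.toSyn.injective h))
    · exact fun h => absurd hα h
  rw [hr, coeff_zero, eq_comm, mul_eq_zero] at hcoeff
  rcases hcoeff with h | h
  · exact mem_support_iff.1 hα h
  · rw [← hdeg] at h
    exact hne α (ord.coeff_degree_eq_zero_iff.1 h)

/-- A multiset of pairs that is a chain for the componentwise order is determined by its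
marginals. -/
theorem eq_of_chain_of_marginals {J C K : Type*} [Fintype J] [Fintype C] [LinearOrder J]
    [LinearOrder K] {key : C → K} (hkey : Function.Injective key) (α β : J → C → ℕ)
    (hα : ∀ j k c d, j < k → key d < key c → α j c = 0 ∨ α k d = 0)
    (hβ : ∀ j k c d, j < k → key d < key c → β j c = 0 ∨ β k d = 0)
    (hrow : ∀ j, ∑ c, α j c = ∑ c, β j c) (hcol : ∀ c, ∑ j, α j c = ∑ j, β j c) : α = β := by
  classical
  induction hn : ∑ j, ∑ c, α j c generalizing α β with
  | zero =>
    have hn' : ∑ j, ∑ c, β j c = 0 := by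
      rw [← hn]
      exact Finset.sum_congr rfl fun j _ => (hrow j).symm
    simp only [Finset.sum_eq_zero_iff, Finset.mem_univ, true_implies] at hn hn'
    funext j c
    rw [hn, hn']
  | succ n ih =>
    have hpos : ∃ j c, α j c ≠ 0 := by
      by_contra! h
      simp [h] at hn
    obtain ⟨j₁, c₁, h₁⟩ := hpos
    obtain ⟨j₀, hj₀, hjmin⟩ := Finset.exists_min_image
      (Finset.univ.filter fun j => ∑ c, α j c ≠ 0) id
      ⟨j₁, by simpa using ⟨c₁, h₁⟩⟩
    obtain ⟨c₀, hc₀, hcmin⟩ := Finset.exists_min_image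
      (Finset.univ.filter fun c => ∑ j, α j c ≠ 0) key
      ⟨c₁, by simpa using ⟨j₁, h₁⟩⟩
    simp only [Finset.mem_filter, Finset.mem_univ, true_and, id] at hj₀ hjmin hc₀ hcmin
    -- Northwest corner rule: if the entry in the first nonzero row and first nonzero column
    -- vanished, that row and that column would have nonzero entries further on, and these two would
    -- violate the chain condition. Row and column are fixed by the marginals, so `α` and `β` share
    -- the corner and one unit can be removed from both.
    have corner : ∀ γ : J → C → ℕ,
        (∀ j k c d, j < k → key d < key c → γ j c = 0 ∨ γ k d = 0) →
        (∀ j, ∑ c, α j c = ∑ c, γ j c) → (∀ c, ∑ j, α j c = ∑ j, γ j c) → γ j₀ c₀ ≠ 0 := by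
      intro γ hγ hr hc h0
      rw [hr] at hj₀
      rw [hc] at hc₀
      obtain ⟨c, -, hjc⟩ := Finset.exists_ne_zero_of_sum_ne_zero hj₀
      obtain ⟨j, -, hcj⟩ := Finset.exists_ne_zero_of_sum_ne_zero hc₀
      have hj : j₀ < j := by
        refine lt_of_le_of_ne (hjmin j ?_) (by rintro rfl; exact hcj h0)
        rw [hr]
        exact fun h => hcj (Finset.sum_eq_zero_iff.1 h c₀ (Finset.mem_univ _))
      have hc' : key c₀ < key c := by
        refine lt_of_le_of_ne (hcmin c ?_) (fun h => ?_)
        · rw [hc]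
          exact fun h => hjc (Finset.sum_eq_zero_iff.1 h j₀ (Finset.mem_univ _))
        · rw [← hkey h] at hjc
          exact hjc h0
      rcases hγ j₀ j c c₀ hj hc' with h | h
      · exact hjc h
      · exact hcj h
    have hα0 := corner α hα (fun _ => rfl) (fun _ => rfl)
    have hβ0 := corner β hβ hrow hcol
    set δ : J → C → ℕ := fun j c => if j = j₀ ∧ c = c₀ then 1 else 0 with hδ
    have split : ∀ γ : J → C → ℕ, γ j₀ c₀ ≠ 0 →
        ∀ j c, γ j c = (γ j c - δ j c) + δ j c := by
      intro γ hγ j c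
      simp only [hδ]
      split_ifs with h
      · obtain ⟨rfl, rfl⟩ := h
        omega
      · omega
    have hsub : (fun j c => α j c - δ j c) = fun j c => β j c - δ j c := by
      apply ih
      · intro j k c d hjk hdc
        rcases hα j k c d hjk hdc with h | h
        · left; omega
        · right; omega
      · intro j k c d hjk hdc
        rcases hβ j k c d hjk hdc with h | h
        · left; omega
        · right; omega
      · intro j
        have := hrow j
        rw [Finset.sum_congr rfl fun c _ => split α hα0 j c,
          Finset.sum_congr rfl fun c _ => split β hβ0 j c, Finset.sum_add_distrib,
          Finset.sum_add_distrib] at this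
        exact Nat.add_right_cancel this
      · intro c
        have := hcol c
        rw [Finset.sum_congr rfl fun j _ => split α hα0 j c,
          Finset.sum_congr rfl fun j _ => split β hβ0 j c, Finset.sum_add_distrib,
          Finset.sum_add_distrib] at this
        exact Nat.add_right_cancel this
      · have h1 : ∑ j, ∑ c, δ j c = 1 := by
          simp only [hδ]
          rw [Finset.sum_eq_single j₀, Finset.sum_eq_single c₀] <;> simp +contextual
        rw [Finset.sum_congr rfl fun j _ => Finset.sum_congr rfl fun c _ => split α hα0 j c] at hn
        simp only [Finset.sum_add_distrib, h1] at hn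
        exact Nat.succ_injective hn
    funext j c
    rw [split α hα0 j c, split β hβ0 j c]
    exact congrArg (· + δ j c) (congrFun (congrFun hsub j) c)

end Groebner

/-! ### Leading exponents of the linear forms and the minors -/

section DegRevLex

variable {σ : Type} [LinearOrder σ] [Finite σ]

theorem degRevLex_single_lt {s t : σ} (h : s < t) :
    (degRevLex σ).toSyn (Finsupp.single t 1) < (degRevLex σ).toSyn (Finsupp.single s 1) := by
  rw [degRevLex_lt_iff]
  refine Or.inr ⟨by simp, t, fun j hj => ?_, ?_⟩
  · rw [Finsupp.single_eq_of_ne hj.ne', Finsupp.single_eq_of_ne (h.trans hj).ne']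
  · rw [Finsupp.single_eq_of_ne h.ne', Finsupp.single_eq_same]
    exact one_pos

theorem degRevLex_degree_X_lt {s t : σ} (h : s < t) :
    (degRevLex σ).toSyn ((degRevLex σ).degree (X t : MvPolynomial σ ℂ)) <
      (degRevLex σ).toSyn (Finsupp.single s 1) := by
  rw [MonomialOrder.degree_X]
  exact degRevLex_single_lt h

theorem degRevLex_degree_sum_lt {ι : Type*} {t : Finset ι} {f : ι → MvPolynomial σ ℂ} {s : σ}
    (h : ∀ i ∈ t, (degRevLex σ).toSyn ((degRevLex σ).degree (f i)) <
      (degRevLex σ).toSyn (Finsupp.single s 1)) :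
    (degRevLex σ).toSyn ((degRevLex σ).degree (∑ i ∈ t, f i)) <
      (degRevLex σ).toSyn (Finsupp.single s 1) := by
  refine lt_of_le_of_lt (MonomialOrder.degree_sum_le) ?_
  rw [Finset.sup_lt_iff]
  · exact h
  · refine lt_of_le_of_lt bot_le ((degRevLex_lt_iff 0 _).2 (Or.inl ?_))
    simp

theorem degRevLex_degree_X_add {s : σ} {g : MvPolynomial σ ℂ}
    (h : (degRevLex σ).toSyn ((degRevLex σ).degree g) < (degRevLex σ).toSyn (Finsupp.single s 1)) :
    (degRevLex σ).degree (X s + g) = Finsupp.single s 1 ∧ X s + g ≠ 0 := by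
  have h1 : (degRevLex σ).degree (X s + g) = Finsupp.single s 1 := by
    rw [MonomialOrder.degree_add_of_lt, MonomialOrder.degree_X]
    rwa [MonomialOrder.degree_X]
  refine ⟨h1, MonomialOrder.ne_zero_of_degree_ne_zero (m := degRevLex σ) ?_⟩
  rw [h1]
  simp

/-- Of the two terms of a `2 × 2`-minor, the one that does not contain the smallest unknown is
larger. -/
theorem degRevLex_single_add_single_lt {s₁ s₂ t₁ t₂ : σ} (h₁ : s₁ < t₂) (h₂ : s₂ < t₂)
    (h : t₁ < t₂) :
    (degRevLex σ).toSyn (Finsupp.single t₁ 1 + Finsupp.single t₂ 1) <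
      (degRevLex σ).toSyn (Finsupp.single s₁ 1 + Finsupp.single s₂ 1) := by
  rw [degRevLex_lt_iff]
  refine Or.inr ⟨by simp, t₂, fun j hj => ?_, ?_⟩
  · simp [Finsupp.single_eq_of_ne hj.ne', Finsupp.single_eq_of_ne (h₁.trans hj).ne',
      Finsupp.single_eq_of_ne (h₂.trans hj).ne', Finsupp.single_eq_of_ne (h.trans hj).ne']
  · simp [Finsupp.single_eq_of_ne h₁.ne', Finsupp.single_eq_of_ne h₂.ne']

end DegRevLex

section Leading

variable {l m : ℕ} [NeZero m]

/-- The state of the leading unknown of the entry of `A` in row `j` and column `c`. -/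
def entryState (j : Fin l) (c : Col m) : State l m := oneOff j (lowLetter c.2) (highLetter c.1)

/-- The columns of `A` are ordered as the leading unknowns of their entries. -/
def colKey (c : Col m) : Fin (m - 1) ×ₗ Fin (m - 1) := toLex (c.2, c.1)

theorem colKey_injective : Function.Injective (colKey (m := m)) := by
  rintro ⟨a, b⟩ ⟨c, d⟩ h
  simpa [colKey, and_comm] using h

theorem lowLetter_lt_top (a : Fin (m - 1)) : lowLetter a < (⊤ : Fin m) :=
  lt_top_iff_ne_top.2 (lowLetter_ne_top a)

theorem oneOff_lt_allTop (j : Fin l) (a : Fin (m - 1)) (r r' : Fin m) :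
    oneOff j (lowLetter a) r < allTop r' := by
  refine State.lt_of_letter j (fun k hk => ?_) ?_
  · simp [letter_oneOff, hk.ne]
  · simp [lowLetter_lt_top]

theorem entryState_lt_of_row {j k : Fin l} (h : j < k) (c d : Col m) :
    entryState j c < entryState k d := by
  refine State.lt_of_letter j (fun i hi => ?_) ?_
  · simp [entryState, letter_oneOff, hi.ne, (hi.trans h).ne]
  · simp [entryState, letter_oneOff, h.ne, lowLetter_lt_top]

theorem entryState_lt_of_col (j : Fin l) {c d : Col m} (h : colKey c < colKey d) :
    entryState j c < entryState j d := by
  rcases Prod.Lex.toLex_lt_toLex.1 h with h | ⟨h, h'⟩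
  · refine State.lt_of_letter j (fun i hi => ?_) ?_
    · simp [entryState, letter_oneOff, hi.ne]
    · simpa [entryState, lowLetter] using h
  · refine State.lt_of_final (fun i => ?_) ?_
    · simp only at h
      simp [entryState, letter_oneOff, h]
    · simpa [entryState, highLetter] using h'

theorem entryState_lt_allTop (j : Fin l) (c : Col m) (r : Fin m) : entryState j c < allTop r :=
  oneOff_lt_allTop j _ _ _

/-- Changing letters to `⊤` moves a state up lexicographically, so its unknown becomes smaller. With
two letters different from `⊤`, every other state in the form is a proper change of `s`. -/
theorem degree_linearForm₁ {s : State l m}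
    (hs : ∃ j k : Fin l, j ≠ k ∧ s.letter j ≠ ⊤ ∧ s.letter k ≠ ⊤) :
    (degRevLex (State l m)).degree (linearForm₁ s) = Finsupp.single s 1 ∧ linearForm₁ s ≠ 0 := by
  obtain ⟨j₁, j₂, hne, h₁, h₂⟩ := hs
  have hlt : ∀ j, s < oneOff j (s.letter j) s.final := by
    intro j
    refine State.lt_of_letter_le (fun k => ?_) (by simp) (fun h => ?_)
    · rw [letter_oneOff]
      split_ifs with hk
      · rw [hk]
      · exact le_top
    · rw [h] at h₁ h₂
      simp only [letter_oneOff] at h₁ h₂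
      by_cases hj : j₁ = j
      · subst hj
        simp [hne.symm] at h₂
      · simp [hj] at h₁
  have hlt' : s < allTop s.final := by
    refine State.lt_of_letter_le (fun k => by simp) (by simp) (fun h => ?_)
    rw [h] at h₁
    simp at h₁
  have : linearForm₁ s = X s + (-∑ j : Fin l, X (oneOff j (s.letter j) s.final) +
      C ((l : ℂ) - 1) * X (allTop s.final)) := by
    rw [linearForm₁]
    ring
  rw [this]
  apply degRevLex_degree_X_add
  refine lt_of_le_of_lt MonomialOrder.degree_add_le (max_lt ?_ ?_)
  · rw [MonomialOrder.degree_neg]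
    exact degRevLex_degree_sum_lt fun j _ => degRevLex_degree_X_lt (hlt j)
  · rw [← smul_eq_C_mul]
    exact lt_of_le_of_lt MonomialOrder.degree_smul_le (degRevLex_degree_X_lt hlt')

theorem degree_linearForm₂ (j : Fin l) (a : Fin (m - 1)) :
    (degRevLex (State l m)).degree (linearForm₂ j (lowLetter a)) =
      Finsupp.single (oneOff j (lowLetter a) 0) 1 ∧
    (linearForm₂ j (lowLetter a) : MvPolynomial (State l m) ℂ) ≠ 0 := by
  have : (linearForm₂ j (lowLetter a) : MvPolynomial (State l m) ℂ) =
      X (oneOff j (lowLetter a) 0) + (∑ r, X (oneOff j (lowLetter a) (highLetter r)) -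
        ∑ r, X (allTop r)) := by
    rw [linearForm₂, sum_eq_zero_add_highLetter]
    ring
  rw [this]
  apply degRevLex_degree_X_add
  refine lt_of_le_of_lt MonomialOrder.degree_sub_le (max_lt ?_ ?_)
  · refine degRevLex_degree_sum_lt fun r _ => degRevLex_degree_X_lt ?_
    refine State.lt_of_final (fun k => by simp [letter_oneOff]) ?_
    simp only [final_oneOff]
    exact Fin.pos_iff_ne_zero.2 (highLetter_ne_zero r)
  · exact degRevLex_degree_sum_lt fun r _ => degRevLex_degree_X_lt (oneOff_lt_allTop _ _ _ _)

theorem degree_matrixA (j : Fin l) (c : Col m) :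
    (degRevLex (State l m)).degree (matrixA l m j c) = Finsupp.single (entryState j c) 1 ∧
      matrixA l m j c ≠ 0 := by
  have : matrixA l m j c = X (entryState j c) + -X (allTop (highLetter c.1)) := by
    simp [matrixA, entryState, sub_eq_add_neg]
  rw [this]
  apply degRevLex_degree_X_add
  rw [MonomialOrder.degree_neg]
  exact degRevLex_degree_X_lt (entryState_lt_allTop _ _ _)

/-- The smallest of the four leading unknowns, at row `k` and column `c`, divides only one of the
two products; reverse lexicographically the other product leads. -/
theorem exists_mem_minors {j k : Fin l} {c d : Col m} (hjk : j < k) (hdc : colKey d < colKey c) :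
    ∃ f ∈ minors l m, (degRevLex (State l m)).degree f =
      Finsupp.single (entryState j c) 1 + Finsupp.single (entryState k d) 1 ∧ f ≠ 0 := by
  have hdeg : (degRevLex (State l m)).degree (matrixA l m j c * matrixA l m k d -
      matrixA l m j d * matrixA l m k c) =
        Finsupp.single (entryState j c) 1 + Finsupp.single (entryState k d) 1 := by
    have hp : ∀ c d : Col m, (degRevLex (State l m)).degree (matrixA l m j c * matrixA l m k d) =
        Finsupp.single (entryState j c) 1 + Finsupp.single (entryState k d) 1 := fun c d => by
      rw [MonomialOrder.degree_mul (degree_matrixA j c).2 (degree_matrixA k d).2,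
        (degree_matrixA j c).1, (degree_matrixA k d).1]
    rw [MonomialOrder.degree_sub_of_lt, hp]
    rw [hp, hp]
    exact degRevLex_single_add_single_lt (entryState_lt_of_row hjk _ _)
      (entryState_lt_of_col k hdc) (entryState_lt_of_row hjk _ _)
  have hne : matrixA l m j c * matrixA l m k d - matrixA l m j d * matrixA l m k c ≠ 0 := by
    apply MonomialOrder.ne_zero_of_degree_ne_zero (m := degRevLex (State l m))
    rw [hdeg]
    simp
  have hcd : c ≠ d := by
    rintro rfl
    exact lt_irrefl _ hdc
  -- `minors` orders columns by `(r, a)`, but their unknowns are ordered by `(a, r)`. The listed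
  -- minor may have its columns swapped, which changes only the sign.
  rcases lt_or_gt_of_ne (toLex.injective.ne hcd) with h | h
  · refine ⟨_, ⟨j, k, c, d, hjk, h, rfl⟩, ?_⟩
    rw [Matrix.det_fin_two]
    exact ⟨hdeg, hne⟩
  · refine ⟨_, ⟨j, k, d, c, hjk, h, rfl⟩, ?_⟩
    have : ((matrixA l m).submatrix ![j, k] ![d, c]).det =
        -(matrixA l m j c * matrixA l m k d - matrixA l m j d * matrixA l m k c) := by
      rw [Matrix.det_fin_two]
      simp
    rw [this, MonomialOrder.degree_neg]
    exact ⟨hdeg, neg_ne_zero.2 hne⟩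

end Leading

/-! ### The parametrization -/

section Param

variable {l m : ℕ} [NeZero m]

/-- The unknowns of the parametrization: `u_r`, `λ_j` and `y_{(r,a)}`. -/
abbrev Param (l m : ℕ) : Type := Fin m ⊕ Fin l ⊕ Col m

/-- The substitution of the parametrization `p_{s} = u_{i_l} + ∑_j λ_j y_{i_j, i_l}` of the affine
cone over the variety. -/
def param (l m : ℕ) [NeZero m] : MvPolynomial (State l m) ℂ →ₐ[ℂ] MvPolynomial (Param l m) ℂ :=
  aeval (point (fun r => X (Sum.inl r))
    fun j c => X (Sum.inr (Sum.inl j)) * X (Sum.inr (Sum.inr c)))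

theorem eval_param (x : Param l m → ℂ) (f : MvPolynomial (State l m) ℂ) :
    eval x (param l m f) = eval (point (fun r => x (Sum.inl r))
      fun j c => x (Sum.inr (Sum.inl j)) * x (Sum.inr (Sum.inr c))) f := by
  have h : (eval x).comp (param l m : _ →+* _) = eval (point (fun r => x (Sum.inl r))
      fun j c => x (Sum.inr (Sum.inl j)) * x (Sum.inr (Sum.inr c))) := by
    refine MvPolynomial.ringHom_ext (fun c => ?_) (fun s => ?_)
    · simp [param]
    · simp [param, map_point]
  rw [← h]
  rfl

theorem eval_point_of_param_eq_zero {f : MvPolynomial (State l m) ℂ} (hf : param l m f = 0)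
    (u : Fin m → ℂ) (x : Fin l → ℂ) (y : Col m → ℂ) :
    eval (point u fun j c => x j * y c) f = 0 := by
  have := eval_param (Sum.elim u (Sum.elim x y)) f
  rw [hf, map_zero] at this
  exact this.symm

/-- Some linear order on the unknowns of the parametrization. -/
abbrev paramLinearOrder (l m : ℕ) : LinearOrder (Param l m) :=
  haveI : DecidableRel (WellOrderingRel (α := Param l m)) := Classical.decRel _
  linearOrderOfSTO WellOrderingRel

/-- A term order on the unknowns of the parametrization that refines the degree. -/
def paramOrder (l m : ℕ) : MonomialOrder (Param l m) :=
  letI := paramLinearOrder l m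
  degRevLex (Param l m)

theorem paramOrder_lt {a b : Param l m →₀ ℕ} (h : a.degree < b.degree) :
    (paramOrder l m).toSyn a < (paramOrder l m).toSyn b :=
  letI := paramLinearOrder l m
  (degRevLex_lt_iff a b).2 (Or.inl h)

theorem param_X_ne_zero (s : State l m) : param l m (X s) ≠ 0 := by
  intro h
  have := eval_point_of_param_eq_zero h (fun _ => 1) (fun _ => 0) (fun _ => 0)
  simp [point, rowExt] at this

theorem degree_param_allTop (r : Fin m) :
    (paramOrder l m).degree (param l m (X (allTop r))) = Finsupp.single (Sum.inl r) 1 := by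
  rw [param, aeval_X, point_allTop, MonomialOrder.degree_X]

/-- The image is `u_r + λ_j y_c`, and `paramOrder` compares degrees first, so the quadratic term
leads. -/
theorem degree_param_entryState (j : Fin l) (c : Col m) :
    (paramOrder l m).degree (param l m (X (entryState j c))) =
      Finsupp.single (Sum.inr (Sum.inl j)) 1 + Finsupp.single (Sum.inr (Sum.inr c)) 1 := by
  have h : (paramOrder l m).degree (X (Sum.inr (Sum.inl j)) * X (Sum.inr (Sum.inr c)) :
      MvPolynomial (Param l m) ℂ) =
      Finsupp.single (Sum.inr (Sum.inl j)) 1 + Finsupp.single (Sum.inr (Sum.inr c)) 1 := by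
    rw [MonomialOrder.degree_mul (X_ne_zero _) (X_ne_zero _), MonomialOrder.degree_X,
      MonomialOrder.degree_X]
  rw [param, aeval_X, entryState, point_oneOff, rowExt_lowLetter_highLetter,
    MonomialOrder.degree_add_eq_right_of_lt, h]
  rw [h, MonomialOrder.degree_X]
  apply paramOrder_lt
  simp

/-- The states of the unknowns that are not leading unknowns of the linear forms. -/
def freeState : Fin m ⊕ Fin l × Col m → State l m :=
  Sum.elim allTop fun p => entryState p.1 p.2

theorem freeState_injective : Function.Injective (freeState (l := l) (m := m)) := by
  rintro (r | ⟨j, c⟩) (r' | ⟨k, d⟩) h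
  · have := congrArg State.final h
    simpa [freeState] using this
  · exact absurd h (entryState_lt_allTop k d r).ne'
  · exact absurd h (entryState_lt_allTop j c r').ne
  · simp only [freeState, Sum.elim_inr] at h
    rcases lt_trichotomy j k with hjk | rfl | hjk
    · exact absurd h (entryState_lt_of_row hjk c d).ne
    · rcases lt_trichotomy (colKey c) (colKey d) with hcd | hcd | hcd
      · exact absurd h (entryState_lt_of_col j hcd).ne
      · rw [colKey_injective hcd]
      · exact absurd h (entryState_lt_of_col j hcd).ne'
    · exact absurd h (entryState_lt_of_row hjk d c).ne'

/-- The exponents of the monomials that are not divisible by the leading monomials of the linear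
forms and the minors. -/
structure IsStandard (α : State l m →₀ ℕ) : Prop where
  eq_zero_of_notMem : ∀ s ∉ Set.range (freeState (l := l) (m := m)), α s = 0
  chain : ∀ (j k : Fin l) (c d : Col m), j < k → colKey d < colKey c →
    α (entryState j c) = 0 ∨ α (entryState k d) = 0

/-- An unknown outside the range of `freeState` leads a linear form, and a violation of the chain
condition gives divisibility by the leading monomial of a minor. -/
theorem isStandard_of_not_degree_le (hl : 0 < l) {α : State l m →₀ ℕ}
    (h : ∀ b ∈ linearForms l m ∪ minors l m, b ≠ 0 → ¬(degRevLex (State l m)).degree b ≤ α) :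
    IsStandard α where
  eq_zero_of_notMem s hs := by
    by_contra hα
    by_cases h2 : ∃ j k : Fin l, j ≠ k ∧ s.letter j ≠ ⊤ ∧ s.letter k ≠ ⊤
    · refine h _ (Or.inl (Or.inl ⟨s, h2, rfl⟩)) (degree_linearForm₁ h2).2 ?_
      rw [(degree_linearForm₁ h2).1, Finsupp.single_le_iff]
      omega
    · obtain ⟨j, hj⟩ := exists_eq_oneOff hl h2
      rcases eq_top_or_lowLetter (s.letter j) with ha | ⟨a, ha⟩
      · rw [ha, oneOff_top] at hj
        exact hs ⟨Sum.inl s.final, hj.symm⟩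
      · rw [ha] at hj
        rcases eq_zero_or_highLetter s.final with hr | ⟨r, hr⟩
        · rw [hr] at hj
          refine h _ (Or.inl (Or.inr ⟨j, a, rfl⟩)) (degree_linearForm₂ j a).2 ?_
          rw [(degree_linearForm₂ j a).1, Finsupp.single_le_iff, ← hj]
          omega
        · rw [hr] at hj
          exact hs ⟨Sum.inr (j, (r, a)), hj.symm⟩
  chain j k c d hjk hdc := by
    by_contra! hα
    obtain ⟨f, hf, hdeg, hf0⟩ := exists_mem_minors (l := l) hjk hdc
    refine h f (Or.inr hf) hf0 ?_
    have hne : entryState j c ≠ entryState k d := (entryState_lt_of_row hjk c d).ne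
    rw [hdeg]
    intro s
    simp only [Finsupp.add_apply, Finsupp.single_apply]
    split_ifs with h1 h2 h2
    · exact absurd (h1.trans h2.symm) hne
    · rw [← h1]
      omega
    · rw [← h2]
      omega
    · omega

/-- The leading exponent of the image of a monomial under the parametrization. -/
def leadExp (α : State l m →₀ ℕ) : Param l m →₀ ℕ :=
  α.sum fun s n => n • (paramOrder l m).degree (param l m (X s))

theorem leadExp_eq {α : State l m →₀ ℕ} (hα : IsStandard α) :
    leadExp α = ∑ r, α (allTop r) • Finsupp.single (Sum.inl r) 1 +
      ∑ j, ∑ c, α (entryState j c) •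
        (Finsupp.single (Sum.inr (Sum.inl j)) 1 + Finsupp.single (Sum.inr (Sum.inr c)) 1) := by
  rw [leadExp, Finsupp.sum_fintype _ _ (fun s => by simp),
    ← Fintype.sum_of_injective freeState freeState_injective
      (fun i => α (freeState i) • (paramOrder l m).degree (param l m (X (freeState i)))) _
      (fun s hs => by rw [hα.eq_zero_of_notMem s hs, zero_smul]) (fun _ => rfl),
    Fintype.sum_sum_type, Fintype.sum_prod_type]
  simp only [freeState, Sum.elim_inl, Sum.elim_inr, degree_param_allTop, degree_param_entryState]

theorem leadExp_inl {α : State l m →₀ ℕ} (hα : IsStandard α) (r : Fin m) :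
    leadExp α (Sum.inl r) = α (allTop r) := by
  rw [leadExp_eq hα]
  simp [Finsupp.single_apply]

theorem leadExp_row {α : State l m →₀ ℕ} (hα : IsStandard α) (j : Fin l) :
    leadExp α (Sum.inr (Sum.inl j)) = ∑ c, α (entryState j c) := by
  rw [leadExp_eq hα]
  simp only [Finsupp.add_apply, Finsupp.finsetSum_apply, Finsupp.smul_apply, Finsupp.single_apply]
  simp

theorem leadExp_col {α : State l m →₀ ℕ} (hα : IsStandard α) (c : Col m) :
    leadExp α (Sum.inr (Sum.inr c)) = ∑ j, α (entryState j c) := by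
  rw [leadExp_eq hα]
  simp only [Finsupp.add_apply, Finsupp.finsetSum_apply, Finsupp.smul_apply, Finsupp.single_apply]
  simp

/-- The exponents of `λ_j` and `y_c` are the row and column sums of the chain `α (entryState j c)`,
and those of `u_r` are the remaining entries of `α`. -/
theorem leadExp_injOn : Set.InjOn (leadExp (l := l) (m := m)) {α | IsStandard α} := by
  intro α hα β hβ h
  have key := eq_of_chain_of_marginals colKey_injective (fun j c => α (entryState j c))
    (fun j c => β (entryState j c)) hα.chain hβ.chain
    (fun j => by rw [← leadExp_row hα, h, leadExp_row hβ])
    (fun c => by rw [← leadExp_col hα, h, leadExp_col hβ])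
  ext s
  by_cases hs : s ∈ Set.range (freeState (l := l) (m := m))
  · obtain ⟨r | ⟨j, c⟩, rfl⟩ := hs
    · have := leadExp_inl hα r
      rw [h, leadExp_inl hβ] at this
      exact this.symm
    · exact congrFun (congrFun key j) c
  · rw [hα.eq_zero_of_notMem s hs, hβ.eq_zero_of_notMem s hs]

theorem mem_ker_param_of_mem {f : MvPolynomial (State l m) ℂ}
    (hf : f ∈ linearForms l m ∪ minors l m) : f ∈ RingHom.ker (param l m) := by
  rw [RingHom.mem_ker]
  rcases hf with hf | hf
  · exact aeval_point_of_mem_linearForms _ _ hf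
  · exact aeval_point_of_mem_minors _ _ _ hf

/-- The linear forms and the minors form a Gröbner basis of the kernel of the parametrization. -/
theorem groebner_ker_param (hl : 0 < l) :
    Ideal.span (linearForms l m ∪ minors l m) = RingHom.ker (param l m) ∧
      Ideal.span ((degRevLex (State l m)).leadingTerm '' (linearForms l m ∪ minors l m)) =
        Ideal.span ((degRevLex (State l m)).leadingTerm ''
          (RingHom.ker (param l m) : Set (MvPolynomial (State l m) ℂ))) := by
  refine span_eq_and_span_leadingTerm_eq _ (fun f hf => mem_ker_param_of_mem hf) fun r hr h => ?_
  refine eq_zero_of_aeval_eq_zero (paramOrder l m) (g := fun s => param l m (X s)) param_X_ne_zero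
    (leadExp_injOn.mono fun α hα => isStandard_of_not_degree_le hl (h α hα)) ?_
  rw [RingHom.mem_ker] at hr
  rw [← hr]
  simp [param]

end Param

/-! ### Homogeneous polynomials on projective space -/

section Homogeneous

variable {σ : Type}

theorem eval_smul_of_isHomogeneous {f : MvPolynomial σ ℂ} {n : ℕ} (hf : f.IsHomogeneous n) (c : ℂ)
    (v : σ → ℂ) : eval (c • v) f = c ^ n * eval v f := by
  rw [eval_eq, eval_eq, Finset.mul_sum]
  refine Finset.sum_congr rfl fun d hd => ?_
  have hdeg : ∑ i ∈ d.support, d i = n := by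
    have := hf (mem_support_iff.1 hd)
    simpa [Finsupp.weight_apply, Finsupp.sum] using this
  simp only [Pi.smul_apply, smul_eq_mul, mul_pow, Finset.prod_mul_distrib]
  rw [Finset.prod_pow_eq_pow_sum, hdeg]
  ring

theorem eval_rep_mk_eq_zero_iff {f : MvPolynomial σ ℂ} {n : ℕ} (hf : f.IsHomogeneous n)
    {v : σ → ℂ} (hv : v ≠ 0) : eval (Projectivization.mk ℂ v hv).rep f = 0 ↔ eval v f = 0 := by
  obtain ⟨a, ha⟩ := Projectivization.exists_smul_eq_mk_rep ℂ v hv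
  rw [← ha, Units.smul_def, eval_smul_of_isHomogeneous hf]
  simp

theorem homogeneousVanishing_zariskiClosure (S : Set (ℙ ℂ (σ → ℂ))) :
    homogeneousVanishing (zariskiClosure S) = homogeneousVanishing S := by
  ext f
  refine ⟨fun h => ⟨h.1, fun x hx => h.2 x fun g hg => hg.2 x hx⟩,
    fun h => ⟨h.1, fun x hx => hx f h⟩⟩

end Homogeneous

section Forms

variable {l m : ℕ} [NeZero m]

theorem isHomogeneous_of_mem_linearForms {f : MvPolynomial (State l m) ℂ}
    (hf : f ∈ linearForms l m) : f.IsHomogeneous 1 := by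
  rcases hf with ⟨s, -, rfl⟩ | ⟨j, a, rfl⟩
  · exact ((isHomogeneous_X _ _).sub (IsHomogeneous.sum _ _ _ fun j _ => isHomogeneous_X _ _)).add
      (isHomogeneous_C_mul_X _ _)
  · exact (IsHomogeneous.sum _ _ _ fun j _ => isHomogeneous_X _ _).sub
      (IsHomogeneous.sum _ _ _ fun j _ => isHomogeneous_X _ _)

theorem isHomogeneous_matrixA (j : Fin l) (c : Col m) : (matrixA l m j c).IsHomogeneous 1 :=
  (isHomogeneous_X _ _).sub (isHomogeneous_X _ _)

theorem isHomogeneous_of_mem_minors {f : MvPolynomial (State l m) ℂ}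
    (hf : f ∈ minors l m) : f.IsHomogeneous 2 := by
  obtain ⟨j, k, c, d, -, -, rfl⟩ := hf
  rw [Matrix.det_fin_two]
  exact ((isHomogeneous_matrixA _ _).mul (isHomogeneous_matrixA _ _)).sub
    ((isHomogeneous_matrixA _ _).mul (isHomogeneous_matrixA _ _))

theorem finite_linearForms (l m : ℕ) [NeZero m] : (linearForms l m).Finite := by
  refine Set.Finite.union ?_ ?_
  · refine (Set.finite_range (linearForm₁ (l := l) (m := m))).subset ?_
    rintro _ ⟨s, -, rfl⟩
    exact ⟨s, rfl⟩
  · refine (Set.finite_range fun p : Fin l × Fin (m - 1) =>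
      (linearForm₂ p.1 (lowLetter p.2) : MvPolynomial (State l m) ℂ)).subset ?_
    rintro _ ⟨j, a, rfl⟩
    exact ⟨(j, a), rfl⟩

theorem finite_minors (l m : ℕ) [NeZero m] : (minors l m).Finite := by
  refine (Set.finite_range fun p : (Fin l × Fin l) × Col m × Col m =>
    ((matrixA l m).submatrix ![p.1.1, p.1.2] ![p.2.1, p.2.2]).det).subset ?_
  rintro _ ⟨j, k, c, d, -, -, rfl⟩
  exact ⟨((j, k), (c, d)), rfl⟩

end Forms

/-! ### The model and the parametrization -/

section Model

variable {l m : ℕ} [NeZero m]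

/-- Every point of the model is a point of the parametrization. -/
theorem exists_point_eq_of_mem_model {p : State l m → ℝ} (hp : p ∈ model l m) :
    ∃ (u : Fin m → ℝ) (x : Fin l → ℝ) (y : Col m → ℝ), p = point u fun j c => x j * y c := by
  obtain ⟨q, lam, hq, hlam, rfl⟩ := hp
  refine ⟨fun r => q ⊤ r / (m : ℝ) ^ l, lam, fun c =>
    (q (lowLetter c.2) (highLetter c.1) - q ⊤ (highLetter c.1)) / (m : ℝ) ^ l, ?_⟩
  funext s
  have h := fun a r => rowExt_restrict (fun a r => (q a r - q ⊤ r) / (m : ℝ) ^ l)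
    (fun r => by simp) (fun a => by
      rw [← Finset.sum_div, Finset.sum_sub_distrib, (hq a).2, (hq ⊤).2]
      simp) a r
  simp only [point, rowExt_smul, h, phi]
  have h1 : q ⊤ s.final / (m : ℝ) ^ l = ∑ j, lam j * (q ⊤ s.final / (m : ℝ) ^ l) := by
    rw [← Finset.sum_mul, hlam.2, one_mul]
  rw [h1, ← Finset.sum_add_distrib, Finset.mul_sum]
  refine Finset.sum_congr rfl fun j _ => ?_
  ring

/-- An open set of real points of the parametrization lies on the affine cone over the model. -/
theorem exists_mem_model_smul_eq_point (hl : 0 < l) {u : Fin m → ℝ} {x : Fin l → ℝ} {y : Col m → ℝ}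
    (hu : ∀ r, 1 ≤ u r) (hx : ∀ j, x j ∈ Set.Ioc (0 : ℝ) 1)
    (hy : ∀ c, y c ∈ Set.Icc (0 : ℝ) (1 / (l * m))) :
    ∃ p ∈ model l m, ∃ t : ℝ, (point u fun j c => x j * y c) = t • p := by
  have hm : (0 : ℝ) < m := Nat.cast_pos.2 (Nat.pos_of_ne_zero (NeZero.ne m))
  have hl' : (0 : ℝ) < l := Nat.cast_pos.2 hl
  have : Nonempty (Fin l) := ⟨⟨0, hl⟩⟩
  have : Nonempty (Fin m) := ⟨0⟩
  set T := ∑ r, u r with hT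
  set Λ := ∑ j, x j with hΛ
  have hTpos : 0 < T := Finset.sum_pos (fun r _ => by linarith [hu r]) Finset.univ_nonempty
  have hΛpos : 0 < Λ := Finset.sum_pos (fun j _ => (hx j).1) Finset.univ_nonempty
  have hΛle : Λ ≤ l := by
    calc Λ ≤ ∑ _j : Fin l, (1 : ℝ) := Finset.sum_le_sum fun j _ => (hx j).2
      _ = l := by simp
  -- The column `0` holds minus a sum of `m - 1` entries, each at most `1 / (l * m)`; all other
  -- entries are nonnegative.
  have hrow : ∀ a r, -(1 / (l : ℝ)) ≤ rowExt y a r := by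
    intro a r
    have h0 : -(1 / (l : ℝ)) ≤ 0 := by
      have : 0 < 1 / (l : ℝ) := by positivity
      linarith
    rcases eq_top_or_lowLetter a with rfl | ⟨a, rfl⟩
    · rwa [rowExt_top]
    · rcases eq_zero_or_highLetter r with rfl | ⟨r, rfl⟩
      · rw [rowExt_lowLetter_zero, neg_le_neg_iff]
        calc ∑ k, y (k, a) ≤ ∑ _k : Fin (m - 1), 1 / ((l : ℝ) * m) :=
              Finset.sum_le_sum fun k _ => (hy _).2
          _ = ((m - 1 : ℕ) : ℝ) * (1 / (l * m)) := by simp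
          _ ≤ (m : ℝ) * (1 / (l * m)) := by
              gcongr
              exact Nat.sub_le _ _
          _ = 1 / l := by field_simp
      · rw [rowExt_lowLetter_highLetter]
        exact h0.trans (hy _).1
  -- The weights are normalized by `Λ`, which multiplies `y` by `Λ`, and the rows by their common
  -- sum `T`. Nonnegativity follows from `u r ≥ 1`, `Λ ≤ l` and the lower bound `-1 / l` on `rowExt
  -- y`.
  refine ⟨_, ⟨fun a r => (u r + Λ * rowExt y a r) / T, fun j => x j / Λ, fun a => ⟨fun r => ?_, ?_⟩,
    ⟨fun j => ?_, ?_⟩, rfl⟩, T * (m : ℝ) ^ l, ?_⟩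
  · apply div_nonneg _ hTpos.le
    have h1 : Λ * (1 / (l : ℝ)) ≤ 1 := by
      rw [mul_one_div, div_le_one hl']
      exact hΛle
    have h2 := mul_le_mul_of_nonneg_left (hrow a r) hΛpos.le
    linarith [hu r]
  · rw [← Finset.sum_div, Finset.sum_add_distrib, ← Finset.mul_sum, sum_rowExt]
    simp [← hT, hTpos.ne']
  · exact div_nonneg (hx j).1.le hΛpos.le
  · rw [← Finset.sum_div, div_self hΛpos.ne']
  · funext s
    have h1 : u s.final = ∑ j, x j / Λ * u s.final := by
      rw [← Finset.sum_mul, ← Finset.sum_div, div_self hΛpos.ne', one_mul]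
    have h2 : u s.final + ∑ j, x j * rowExt y (s.letter j) s.final =
        ∑ j, (x j / Λ * u s.final + x j * rowExt y (s.letter j) s.final) := by
      rw [Finset.sum_add_distrib, ← h1]
    simp only [point, rowExt_smul, phi, Pi.smul_apply, smul_eq_mul]
    rw [h2, ← mul_assoc, Finset.mul_sum]
    refine Finset.sum_congr rfl fun j _ => ?_
    field_simp

theorem ofReal_point (u : Fin m → ℝ) (d : Fin l → Col m → ℝ) :
    (fun s => ((point u d s : ℝ) : ℂ)) =
      point (fun r => (u r : ℂ)) (fun j c => (d j c : ℂ)) :=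
  funext fun s => map_point Complex.ofRealHom u d s

/-- A homogeneous polynomial vanishes on the model if and only if it is annihilated by the
parametrization. -/
theorem homogeneousVanishing_projModel (hl : 0 < l) :
    homogeneousVanishing (projModel l m) =
      {f | (∃ n, f.IsHomogeneous n) ∧ param l m f = 0} := by
  ext f
  refine and_congr_right fun ⟨n, hn⟩ => ⟨fun h => ?_, fun h => ?_⟩
  · have hmodel : ∀ p ∈ model l m, (fun s => (p s : ℂ)) ≠ 0 → eval (fun s => (p s : ℂ)) f = 0 :=
      fun p hp h0 => (eval_rep_mk_eq_zero_iff hn h0).1 (h _ ⟨p, hp, h0, rfl⟩)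
    have hinj : Set.InjOn (fun t : ℝ => (t : ℂ)) Set.univ := Complex.ofReal_injective.injOn
    have hlm : (0 : ℝ) < 1 / (l * m) := by
      have : (0 : ℝ) < m := Nat.cast_pos.2 (Nat.pos_of_ne_zero (NeZero.ne m))
      positivity
    -- A polynomial vanishing on a product of infinite sets is zero, so real parameters in the box
    -- suffice.
    refine funext_set (Sum.elim (fun _ => (fun t : ℝ => (t : ℂ)) '' Set.Ici 1)
      (Sum.elim (fun _ => (fun t : ℝ => (t : ℂ)) '' Set.Ioc 0 1)
        fun _ => (fun t : ℝ => (t : ℂ)) '' Set.Icc 0 (1 / (l * m)))) ?_ ?_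
    · rintro (r | j | c)
      · exact (Set.Ici_infinite _).image (hinj.mono (Set.subset_univ _))
      · exact (Set.Ioc_infinite one_pos).image (hinj.mono (Set.subset_univ _))
      · exact (Set.Icc_infinite hlm).image (hinj.mono (Set.subset_univ _))
    · intro z hz
      have hz' := fun i => hz i (Set.mem_univ i)
      choose u hu hu' using fun r => hz' (Sum.inl r)
      choose x hx hx' using fun j => hz' (Sum.inr (Sum.inl j))
      choose y hy hy' using fun c => hz' (Sum.inr (Sum.inr c))
      simp only at hu' hx' hy'
      obtain ⟨p, hp, t, hpt⟩ := exists_mem_model_smul_eq_point hl hu hx hy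
      rw [eval_param, map_zero]
      simp only [← hu', ← hx', ← hy', ← Complex.ofReal_mul]
      rw [← ofReal_point, hpt]
      have hsm : (fun s => (((t • p) s : ℝ) : ℂ)) = (t : ℂ) • fun s => (p s : ℂ) := by
        funext s
        simp
      rw [hsm, eval_smul_of_isHomogeneous hn, hmodel p hp, mul_zero]
      intro h0
      have h1 := congrFun hpt (allTop 0)
      have h2 : (p (allTop 0) : ℂ) = 0 := congrFun h0 (allTop 0)
      rw [point_allTop, Pi.smul_apply, Complex.ofReal_eq_zero.1 h2, smul_zero] at h1
      have h3 : (1 : ℝ) ≤ u 0 := hu 0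
      linarith
  · rintro _ ⟨p, hp, h0, rfl⟩
    rw [eval_rep_mk_eq_zero_iff hn]
    obtain ⟨u, x, y, rfl⟩ := exists_point_eq_of_mem_model hp
    rw [ofReal_point]
    simp only [Complex.ofReal_mul]
    exact eval_point_of_param_eq_zero h _ _ _

/-- The ideal of the variety is the kernel of the parametrization. -/
theorem vanishingIdeal_variety (hl : 0 < l) :
    vanishingIdeal (variety l m) = RingHom.ker (param l m) := by
  rw [vanishingIdeal, variety, homogeneousVanishing_zariskiClosure,
    homogeneousVanishing_projModel hl]
  refine le_antisymm (Ideal.span_le.2 fun f hf => hf.2) ?_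
  -- The kernel is generated by its homogeneous elements, since the linear forms and minors generate
  -- it.
  rw [← (groebner_ker_param hl).1]
  refine Ideal.span_mono fun f hf => ⟨?_, mem_ker_param_of_mem hf⟩
  rcases hf with hf | hf
  · exact ⟨1, isHomogeneous_of_mem_linearForms hf⟩
  · exact ⟨2, isHomogeneous_of_mem_minors hf⟩

theorem mk_point_mem_variety (hl : 0 < l) (u : Fin m → ℂ) (x : Fin l → ℂ) (y : Col m → ℂ)
    (h : point u (fun j c => x j * y c) ≠ 0) :
    Projectivization.mk ℂ (point u fun j c => x j * y c) h ∈ variety l m := by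
  intro f hf
  rw [homogeneousVanishing_projModel hl] at hf
  obtain ⟨⟨n, hn⟩, hf⟩ := hf
  rw [eval_rep_mk_eq_zero_iff hn]
  exact eval_point_of_param_eq_zero hf u x y

end Model

/-! ### The linear span -/

section LinearSpan

variable {l m : ℕ} [NeZero m]

/-- The linear parametrization of the linear span. -/
def pointLinearMap (l m : ℕ) [NeZero m] :
    ((Fin m → ℂ) × (Fin l → Col m → ℂ)) →ₗ[ℂ] (State l m → ℂ) where
  toFun z := point z.1 z.2
  map_add' z w := point_add z.1 w.1 z.2 w.2
  map_smul' c z := point_smul c z.1 z.2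

theorem pointLinearMap_injective : Function.Injective (pointLinearMap l m) := by
  rintro ⟨u, d⟩ ⟨u', d'⟩ h
  change point u d = point u' d' at h
  refine Prod.ext (funext fun r => ?_) (funext fun j => funext fun c => ?_)
  · simpa using congrFun h (allTop r)
  · have h1 := aeval_point_matrixA u d j c
    rw [h, aeval_point_matrixA] at h1
    exact h1.symm

/-- The parameters number `m + l * (m - 1) ^ 2`; the final `+ 1` is the passage from projective to
vector space dimension. -/
theorem finrank_range_pointLinearMap :
    Module.finrank ℂ (LinearMap.range (pointLinearMap l m)) = (m - 1) * (l * m - l + 1) + 1 := by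
  rw [LinearMap.finrank_range_of_inj pointLinearMap_injective]
  simp only [Module.finrank_prod, Module.finrank_pi_fintype, Module.finrank_self, Finset.sum_const,
    Finset.card_univ, Fintype.card_fin, Fintype.card_prod, smul_eq_mul, mul_one]
  obtain ⟨n, rfl⟩ := Nat.exists_eq_succ_of_ne_zero (NeZero.ne m)
  have : l * (n + 1) - l = l * n := by rw [Nat.mul_succ, Nat.add_sub_cancel]
  simp only [Nat.succ_eq_add_one, this, Nat.add_sub_cancel]
  ring

theorem submodule_span_variety (hl : 0 < l) :
    (Projectivization.Subspace.span (variety l m)).submodule =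
      LinearMap.range (pointLinearMap l m) := by
  apply le_antisymm
  · rw [← OrderIso.le_symm_apply, Projectivization.Subspace.span_le_subspace_iff]
    intro x hx
    have hrep : x.rep ∈ LinearMap.range (pointLinearMap l m) := by
      refine ⟨(fun r => x.rep (allTop r), fun j c => eval x.rep (matrixA l m j c)),
        (eq_point_of_eval_linearForms hl fun f hf => hx f ?_).symm⟩
      rw [homogeneousVanishing_projModel hl]
      exact ⟨⟨1, isHomogeneous_of_mem_linearForms hf⟩, mem_ker_param_of_mem (Or.inl hf)⟩
    rw [← x.mk_rep]
    exact (Submodule.mk_mem_projectivization_iff _ x.rep_nonzero).2 hrep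
  · have hmem : ∀ (u : Fin m → ℂ) (x : Fin l → ℂ) (y : Col m → ℂ),
        (point u fun j c => x j * y c) ∈
          (Projectivization.Subspace.span (variety l m)).submodule := by
      intro u x y h
      exact Projectivization.Subspace.subset_span _ (mk_point_mem_variety hl u x y h)
    rintro _ ⟨⟨u, d⟩, rfl⟩
    -- An arbitrary `d` is the sum of the rank-one matrices that keep a single row of it, so points
    -- on the cone over the variety already span.
    have h : pointLinearMap l m (u, d) =
        (point u fun j c => (0 : Fin l → ℂ) j * (0 : Col m → ℂ) c) +
        ∑ k, point 0 fun j c => (Pi.single k 1 : Fin l → ℂ) j * d k c := by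
      funext s
      change point u d s = _
      simp only [Pi.add_apply, Finset.sum_apply, point, rowExt_smul, Pi.zero_apply, zero_mul,
        zero_add]
      rw [Finset.sum_comm]
      simp [rowExt_zero, Pi.single_apply]
    rw [h]
    exact Submodule.add_mem _ (hmem _ _ _) (Submodule.sum_mem _ fun k _ => hmem _ _ _)

theorem vanishingIdeal_span_variety (hl : 0 < l) :
    vanishingIdeal (Projectivization.Subspace.span (variety l m) : Set (PSpace l m)) =
      Ideal.span (linearForms l m) := by
  have hmk : ∀ (v : State l m → ℂ) (hv : v ≠ 0),
      Projectivization.mk ℂ v hv ∈ Projectivization.Subspace.span (variety l m) ↔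
        v ∈ LinearMap.range (pointLinearMap l m) := by
    intro v hv
    rw [← submodule_span_variety hl, Projectivization.Subspace.mem_submodule_iff]
  apply le_antisymm
  · refine Ideal.span_le.2 ?_
    rintro f ⟨⟨n, hn⟩, hf⟩
    have hne : ∀ (u : Fin m → ℂ) (d : Fin l → Col m → ℂ), point u d ≠ 0 →
        eval (point u d) f = 0 := fun u d h =>
      (eval_rep_mk_eq_zero_iff hn h).1 (hf _ ((hmk _ h).2 ⟨(u, d), rfl⟩))
    refine mem_span_linearForms_of_eval_point hl fun u d => ?_
    -- The zero vector is no projective point. The value there is `0 ^ n` times the value at a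
    -- nonzero point of the span, which vanishes; this also covers `n = 0`.
    by_cases h : point u d = 0
    · have h1 : point (fun _ => 1) (fun _ _ => 0) ≠ (0 : State l m → ℂ) := fun h => by
        simpa using congrFun h (allTop 0)
      rw [h, ← zero_smul ℂ (point (fun _ => 1) (fun _ _ => 0) : State l m → ℂ),
        eval_smul_of_isHomogeneous hn, hne _ _ h1, mul_zero]
    · exact hne u d h
  · refine Ideal.span_mono fun f hf => ⟨⟨1, isHomogeneous_of_mem_linearForms hf⟩, fun x hx => ?_⟩
    have hx' : x ∈ Projectivization.Subspace.span (variety l m) := hx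
    rw [← x.mk_rep, hmk] at hx'
    obtain ⟨⟨u, d⟩, hz⟩ := hx'
    rw [← hz]
    exact aeval_point_of_mem_linearForms u d hf

end LinearSpan

end MTD

end

theorem theorem4p1 (l m : ℕ) (hl : 0 < l) [NeZero m] :
    -- the linear span of the variety, and its projective dimension
    Module.finrank ℂ (Projectivization.Subspace.span (MTD.variety l m)).submodule =
        (m - 1) * (l * m - l + 1) + 1 ∧
    MTD.vanishingIdeal (Projectivization.Subspace.span (MTD.variety l m) : Set (MTD.PSpace l m)) =
        Ideal.span (MTD.linearForms l m) ∧
    -- the prime ideal of the variety, inside the homogeneous coordinate ring of the linear span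
    (MTD.vanishingIdeal (MTD.variety l m)).IsPrime ∧
    (MTD.vanishingIdeal (MTD.variety l m)).map (Ideal.Quotient.mk (MTD.vanishingIdeal
        (Projectivization.Subspace.span (MTD.variety l m) : Set (MTD.PSpace l m)))) =
      Ideal.span (Ideal.Quotient.mk (MTD.vanishingIdeal
        (Projectivization.Subspace.span (MTD.variety l m) : Set (MTD.PSpace l m))) ''
          MTD.minors l m) ∧
    -- the Gröbner basis
    MTD.IsGroebnerBasis (MTD.degRevLex (MTD.State l m))
      (MTD.linearForms l m ∪ MTD.minors l m) (MTD.vanishingIdeal (MTD.variety l m)) := by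
  have hL := MTD.vanishingIdeal_span_variety (m := m) hl
  have hV := MTD.vanishingIdeal_variety (m := m) hl
  obtain ⟨hspan, hlead⟩ := MTD.groebner_ker_param (m := m) hl
  refine ⟨?_, hL, ?_, ?_, (MTD.finite_linearForms l m).union (MTD.finite_minors l m), ?_, ?_⟩
  · rw [MTD.submodule_span_variety hl, MTD.finrank_range_pointLinearMap]
  · rw [hV]
    exact RingHom.ker_isPrime _
  -- Modulo the ideal of the linear span the linear forms become zero, leaving only the minors.
  · rw [hL, hV, ← hspan, Ideal.map_span, Set.image_union, Ideal.span_union, ← Ideal.map_span,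
      Ideal.map_quotient_self, bot_sup_eq]
  · rw [hV]
    exact fun f hf => MTD.mem_ker_param_of_mem hf
  · rw [hV]
    exact hlead
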